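/- **Setting.** Let $\mu:[-1,1]\to\mathbb{R}$ be continuous, strictly increasing, twice differentiable except possibly at $0$, with $\mu(0)=0$. Say $\mu$ has *diminishing sensitivity* if $\mu''(x)<0$ and $\mu''(-x)>0$ for all $x\in(0,1]$, and (weak) *loss aversion* if $-\mu(-x)\ge\mu(x)$ for all $x\in(0,1]$. Let $T\ge 2$ and let $\pi_0\in(0,1)$ be the prior probability of the good state among two states $G,B$. The sender knows the state $\theta$. In each period $t=1,\dots,T-1$ she sends a public message from a finite set $M$, drawn from $\sigma(\cdot\mid h^{t-1},\theta)$, where $h^{t-1}\in M^{t-1}$ is the history of earlier messages. The receiver's belief in $G$ after history $h$ is $p(h)\in[0,1]$. In period $T$ he learns the state, so his belief becomes $1$ if $\theta=G$ and $0$ if $\theta=B$. With $\pi_t$ the belief in period $t$, the receiver's total news utility is $\sum_{t=1}^{T}\mu(\pi_t-\pi_{t-1})$. An *equilibrium* is a triple $(M,\sigma,p)$ such that: - for every $1\le t\le T-1$, every $h^{t-1}\in M^{t-1}$ and each state $\theta$, $\sigma$ maximizes, over all sender strategies, the receiver's expected news utility in periods $t,\dots,T$ conditional on $h^{t-1}$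 and $\theta$; - $p(\varnothing)=\pi_0$, and $p(h,m)$ is obtained from $p(h)$ by Bayes' rule with $\sigma$ whenever $p(h)\sigma(m\mid h,G)+(1-p(h))\sigma(m\mid h,B)>0$; - if $p(h)\in\{0,1\}$, then $p(h')=p(h)$ for every continuation $h'$ of $h$ through period $T-1$. It is a *(deterministic) gradual good news equilibrium* if there are constants $\pi_0=p_0\le p_1\le\dots\le p_T=1$ such that in the good state the receiver's belief in period $t$ is always $p_t$. Its *intermediate beliefs* are the distinct elements of $\{p_0,\dots,p_{T-1}\}\cap(\pi_0,1)$. For $x,\pi\in[0,1]$ let $N_B(x;\pi)=\mu(x-\pi)+\mu(-x)$, the total news utility along the belief path $\pi\to x\to 0$, and let $P^*(\pi)=\{x\in(\pi,1] : N_B(x;\pi)=N_B(0;\pi)\}$. **Proposition.** Suppose $\mu$ has diminishing sensitivity and loss aversion. Let $1\le J\le T-1$, let $q^{(1)}<\dots<q^{(J)}<1$ be real numbers, and put $q^{(0)}=\pi_0$. There exists a gradual good news equilibrium whose intermediate beliefs are exactly $q^{(1)},\dots,q^{(J)}$ if and only if $q^{(j)}\in P^*(q^{(j-1)})$ for every $j=1,\dots,J$.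 -/

import Mathlib

namespace NewsUtility

/-- The interval `[-1, 1]` of possible belief changes, the domain of a gain-loss function. -/
abbrev changes : Set ℝ := Set.Icc (-1) 1

/-- First derivative of a gain-loss function on `[-1, 1]` (one-sided at the end points). -/
noncomputable def deriv1 (μ : ℝ → ℝ) : ℝ → ℝ := derivWithin μ changes

/-- Second derivative of a gain-loss function on `[-1, 1]` (one-sided at the end points). -/
noncomputable def deriv2 (μ : ℝ → ℝ) : ℝ → ℝ := derivWithin (deriv1 μ) changes

/-- A gain-loss utility function `μ : [-1, 1] → ℝ`: continuous, strictly increasing, twice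
differentiable except possibly at `0`, and `μ 0 = 0`. Values outside `[-1, 1]` are irrelevant. -/
structure IsGainLoss (μ : ℝ → ℝ) : Prop where
  continuousOn : ContinuousOn μ changes
  strictMonoOn : StrictMonoOn μ changes
  differentiable : ∀ x ∈ changes, x ≠ 0 → DifferentiableWithinAt ℝ μ changes x
  twice_differentiable : ∀ x ∈ changes, x ≠ 0 → DifferentiableWithinAt ℝ (deriv1 μ) changes x
  map_zero : μ 0 = 0

/-- `μ''(x) < 0` and `μ''(-x) > 0` for all `x > 0` (in the domain). -/
def DiminishingSensitivity (μ : ℝ → ℝ) : Prop :=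
  ∀ x ∈ Set.Ioc (0 : ℝ) 1, deriv2 μ x < 0 ∧ 0 < deriv2 μ (-x)

/-- (Weak) loss aversion: `-μ(-x) ≥ μ(x)` for all `x > 0` (in the domain). -/
def LossAversion (μ : ℝ → ℝ) : Prop :=
  ∀ x ∈ Set.Ioc (0 : ℝ) 1, μ x ≤ -μ (-x)

/-- `N_B(x; π) = μ(x - π) + μ(-x)`: total news utility along the belief path `π → x → 0`. -/
def newsBad (μ : ℝ → ℝ) (x π : ℝ) : ℝ := μ (x - π) + μ (-x)

/-- `P*(π)`: the beliefs `x ∈ (π, 1]` such that `N_B(x; π) = N_B(0; π)`. -/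
def indiffSet (μ : ℝ → ℝ) (π : ℝ) : Set ℝ :=
  {x | x ∈ Set.Ioc π 1 ∧ newsBad μ x π = newsBad μ 0 π}

/-- The two states of the world. -/
inductive State
  | good
  | bad

/-- The degenerate belief (probability of the good state) that is correct in a state. -/
def State.belief : State → ℝ
  | good => 1
  | bad => 0

/-- A public history after `t` messages is a list of length `t`, **most recent message first**;
thus `m :: h` is the history `h` followed by the message `m`. A (behavioural) strategy of the
sender gives, for each history and state, a distribution of the next message. In a game with
horizon `T`, messages are sent in the periods `1, …, T - 1`, so that only the values at histories
of length less than `T - 1` matter. -/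
abbrev Strategy (M : Type) [Fintype M] : Type := List M → State → stdSimplex ℝ M

section Game

variable {M : Type} [Fintype M]

/-- The probability that the sender sends message `m` next, after history `h` in state `θ`. -/
def Strategy.prob (σ : Strategy M) (h : List M) (θ : State) (m : M) : ℝ :=
  (σ h θ).1 m

/-- The probability in state `θ` that the first `h.length` messages form the history `h`. -/
def historyProb (σ : Strategy M) (θ : State) : List M → ℝ
  | [] => 1
  | m :: h => historyProb σ θ h * σ.prob h θ m

/-- The expected total news utility from now on, in state `θ`, when the history so far is `h`,
messages are still to be sent in `n` further periods according to `σ`, the beliefs of the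
receiver are given by `p`, and he learns the true state in the period after the last message. -/
noncomputable def payoff (μ : ℝ → ℝ) (p : List M → ℝ) (σ : Strategy M) (θ : State) :
    ℕ → List M → ℝ
  | 0, h => μ (θ.belief - p h)
  | n + 1, h => ∑ m : M, σ.prob h θ m * (μ (p (m :: h) - p h) + payoff μ p σ θ n (m :: h))

/-- Perfect-Bayesian equilibrium of the cheap-talk game with horizon `T` and prior `π₀`, with
the two belief refinements: degenerate beliefs persist through period `T - 1`, and in period `T`
the belief is the correct degenerate one (the latter is part of `payoff`). -/
structure IsEquilibrium (μ : ℝ → ℝ) (T : ℕ) (π₀ : ℝ) (σ : Strategy M) (p : List M → ℝ) :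
    Prop where
  belief_mem : ∀ h : List M, h.length ≤ T - 1 → p h ∈ Set.Icc (0 : ℝ) 1
  /-- At every history (on or off path) before a message, and in each state, the continuation of
  `σ` maximizes the expected news utility over all strategies. -/
  optimal : ∀ h : List M, h.length < T - 1 → ∀ (θ : State) (σ' : Strategy M),
    payoff μ p σ' θ (T - 1 - h.length) h ≤ payoff μ p σ θ (T - 1 - h.length) h
  prior : p [] = π₀
  /-- Bayes' rule, whenever the message has positive probability under the current belief. -/
  bayes : ∀ (h : List M) (m : M), h.length < T - 1 →
    0 < p h * σ.prob h .good m + (1 - p h) * σ.prob h .bad m →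
    p (m :: h) = p h * σ.prob h .good m /
      (p h * σ.prob h .good m + (1 - p h) * σ.prob h .bad m)
  degenerate : ∀ h h' : List M, h'.length ≤ T - 1 → h <:+ h' → p h = 0 ∨ p h = 1 → p h' = p h

/-- The receiver's beliefs in the good state follow the deterministic path
`b 0 ≤ b 1 ≤ … ≤ b T`, with `b 0 = π₀` and `b T = 1` (the belief in period `T` in the good state
is always `1`). -/
structure IsGradualPath (T : ℕ) (π₀ : ℝ) (σ : Strategy M) (p : List M → ℝ)
    (b : Fin (T + 1) → ℝ) : Prop where
  monotone : Monotone b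
  first : b 0 = π₀
  last : b (Fin.last T) = 1
  belief_eq : ∀ t : Fin T, ∀ h : List M, h.length = t → 0 < historyProb σ .good h →
    p h = b t.castSucc

end Game

/-- The intermediate beliefs of a path: those among `b 0, …, b (T - 1)` that lie in `(π₀, 1)`. -/
def intermediateBeliefs (T : ℕ) (π₀ : ℝ) (b : Fin (T + 1) → ℝ) : Set ℝ :=
  Set.Ioo π₀ 1 ∩ Set.range fun t : Fin T => b t.castSucc

/-- There is a (deterministic) gradual good news equilibrium `(M, σ, p)` whose set of
intermediate beliefs is `S`. -/
def ExistsGradualGoodNews (μ : ℝ → ℝ) (T : ℕ) (π₀ : ℝ) (S : Set ℝ) : Prop :=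
  ∃ (M : Type) (_ : Fintype M) (σ : Strategy M) (p : List M → ℝ) (b : Fin (T + 1) → ℝ),
    IsEquilibrium μ T π₀ σ p ∧ IsGradualPath T π₀ σ p b ∧ intermediateBeliefs T π₀ b = S

end NewsUtility

namespace NewsUtility

/-! Necessity rests on one fact (`payoff_bad_of_isGradualPath`): on the good path at belief `π`, the
bad sender's value is `μ (-π)`. If the belief is about to rise, averaging Bayes' rule forces a
message sent only in the bad state; it drops the belief to `0` for good and is a best reply. A jump
to `x < 1` needs a message that the bad sender also sends, so `μ (x - π) + μ (-x) = μ (-π)`.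

For sufficiency, two messages are enough: good news, with which the bad sender pools just often
enough to move the belief along the path, and a confession of the bad state. The indifference
equations make every strategy optimal in the bad state. In the good state, concavity on gains makes
`μ` subadditive, so the path from `π` is worth at least `μ (1 - π)`. Loss aversion and subadditivity
bound the false confession: `μ (-π) + μ 1 ≤ -μ π + (μ π + μ (1 - π))`. -/

theorem IsGainLoss.concaveOn {μ : ℝ → ℝ} (hμ : IsGainLoss μ) (hds : DiminishingSensitivity μ) :
    ConcaveOn ℝ (Set.Icc 0 1) μ := by
  refine (strictConcaveOn_of_deriv2_neg (convex_Icc 0 1)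
    (hμ.continuousOn.mono (Set.Icc_subset_Icc (by norm_num) le_rfl)) ?_).concaveOn
  intro x hx
  rw [interior_Icc] at hx
  have hnhds : ∀ y ∈ Set.Ioo (0 : ℝ) 1, changes ∈ nhds y := fun y hy =>
    Icc_mem_nhds (by linarith [hy.1]) hy.2
  have heq : deriv1 μ =ᶠ[nhds x] deriv μ := by
    filter_upwards [Ioo_mem_nhds hx.1 hx.2] with y hy
    exact derivWithin_of_mem_nhds (hnhds y hy)
  have h := (hds x ⟨hx.1, hx.2.le⟩).1
  rw [deriv2, derivWithin_of_mem_nhds (hnhds x hx), heq.deriv_eq] at h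
  exact h

theorem subadditive_of_concaveOn {μ : ℝ → ℝ} (hc : ConcaveOn ℝ (Set.Icc 0 1) μ) (h0 : μ 0 = 0)
    {x y : ℝ} (hx : 0 ≤ x) (hy : 0 ≤ y) (hxy : x + y ≤ 1) : μ (x + y) ≤ μ x + μ y := by
  rcases (add_nonneg hx hy).eq_or_lt with h | h
  · have hx' : x = 0 := by linarith
    have hy' : y = 0 := by linarith
    simp [hx', hy', h0]
  -- The graph lies above its chord from `0` to `x + y`; the bounds at `x` and at `y` add up.
  · have scale : ∀ a b : ℝ, 0 ≤ a → 0 ≤ b → a + b = x + y →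
        a / (x + y) * μ (x + y) ≤ μ a := by
      intro a b ha hb hab
      have := hc.2 (show x + y ∈ Set.Icc (0 : ℝ) 1 from ⟨h.le, hxy⟩)
        (show (0 : ℝ) ∈ Set.Icc (0 : ℝ) 1 from ⟨le_rfl, zero_le_one⟩)
        (show 0 ≤ a / (x + y) by positivity) (show 0 ≤ b / (x + y) by positivity)
        (by rw [← add_div, hab, div_self h.ne'])
      simpa [h0, div_mul_cancel₀ a h.ne'] using this
    have h1 := scale x y hx hy rfl
    have h2 := scale y x hy hx (add_comm _ _)
    have h3 : x / (x + y) * μ (x + y) + y / (x + y) * μ (x + y) = μ (x + y) := by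
      field_simp
    linarith

/-! ### Payoffs, one-shot deviations and Bayes' rule -/

section Game

variable {M : Type} [Fintype M]

theorem Strategy.prob_nonneg (σ : Strategy M) (h : List M) (θ : State) (m : M) :
    0 ≤ σ.prob h θ m := (σ h θ).2.1 m

theorem Strategy.sum_prob (σ : Strategy M) (h : List M) (θ : State) :
    ∑ m, σ.prob h θ m = 1 := (σ h θ).2.2

theorem Strategy.exists_prob_pos (σ : Strategy M) (h : List M) (θ : State) :
    ∃ m, 0 < σ.prob h θ m := by
  by_contra! hc
  have := Finset.sum_nonpos fun m (_ : m ∈ Finset.univ) => hc m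
  linarith [σ.sum_prob h θ]

theorem exists_historyProb_pos (σ : Strategy M) (θ : State) (n : ℕ) :
    ∃ h : List M, h.length = n ∧ 0 < historyProb σ θ h := by
  induction n with
  | zero => exact ⟨[], rfl, zero_lt_one⟩
  | succ n ih =>
    obtain ⟨h, rfl, hpos⟩ := ih
    obtain ⟨m, hm⟩ := σ.exists_prob_pos h θ
    exact ⟨m :: h, rfl, mul_pos hpos hm⟩

/-- Continuation payoffs only depend on the strategy at later histories. -/
theorem payoff_congr (μ : ℝ → ℝ) (p : List M → ℝ) {σ σ' : Strategy M} (θ : State) {k : ℕ}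
    (hσ : ∀ h, k ≤ h.length → σ h = σ' h) (n : ℕ) (h : List M) (hk : k ≤ h.length) :
    payoff μ p σ θ n h = payoff μ p σ' θ n h := by
  induction n generalizing h with
  | zero => rfl
  | succ n ih =>
    simp only [payoff, Strategy.prob, hσ h hk]
    exact Finset.sum_congr rfl fun m _ => by rw [ih (m :: h) (by simp; omega)]

/-- If the payoff of every next message is `v`, then so is the expected payoff. -/
theorem payoff_succ_eq_of_forall (μ : ℝ → ℝ) (p : List M → ℝ) (σ : Strategy M) (θ : State)
    (n : ℕ) (h : List M) {v : ℝ}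
    (hv : ∀ m, 0 < σ.prob h θ m → μ (p (m :: h) - p h) + payoff μ p σ θ n (m :: h) = v) :
    payoff μ p σ θ (n + 1) h = v := by
  have : ∀ m ∈ Finset.univ,
      σ.prob h θ m * (μ (p (m :: h) - p h) + payoff μ p σ θ n (m :: h)) = σ.prob h θ m * v := by
    intro m _
    rcases (σ.prob_nonneg h θ m).eq_or_lt with h0 | h0
    · rw [← h0, zero_mul, zero_mul]
    · rw [hv m h0]
  rw [payoff, Finset.sum_congr rfl this, ← Finset.sum_mul, σ.sum_prob, one_mul]

theorem payoff_of_belief_const {μ : ℝ → ℝ} (h0 : μ 0 = 0) {p : List M → ℝ} (σ : Strategy M)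
    (θ : State) (n : ℕ) (h : List M)
    (hp : ∀ h', h <:+ h' → h'.length ≤ h.length + n → p h' = p h) :
    payoff μ p σ θ n h = μ (θ.belief - p h) := by
  induction n generalizing h with
  | zero => rfl
  | succ n ih =>
    refine payoff_succ_eq_of_forall μ p σ θ n h fun m _ => ?_
    have hm : p (m :: h) = p h := hp _ (List.suffix_cons m h) (by simp)
    rw [ih (m :: h), hm, sub_self, h0, zero_add]
    intro h' hs hl
    rw [hm]
    exact hp h' ((List.suffix_cons m h).trans hs) (by simp at hl; omega)

open Classical in
/-- Follow `σ`, except that `m` is sent for sure at the history `h`. -/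
noncomputable def Strategy.deviate (σ : Strategy M) (h : List M) (m : M) : Strategy M :=
  fun h' θ => if h' = h then ⟨Pi.single m 1, single_mem_stdSimplex ℝ m⟩ else σ h' θ

theorem payoff_deviate (μ : ℝ → ℝ) (p : List M → ℝ) (σ : Strategy M) (θ : State) (n : ℕ)
    (h : List M) (m : M) :
    payoff μ p (σ.deviate h m) θ (n + 1) h =
      μ (p (m :: h) - p h) + payoff μ p σ θ n (m :: h) := by
  classical
  refine payoff_succ_eq_of_forall μ p _ θ n h fun m' hm' => ?_
  have : m' = m := by
    by_contra hne
    simp [Strategy.prob, Strategy.deviate, hne] at hm'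
  subst this
  congr 1
  -- Later payoffs only see histories longer than `h`, where the deviation agrees with `σ`.
  refine payoff_congr μ p θ (k := h.length + 1) (fun h' hl => ?_) n (m' :: h) (by simp)
  have hne : h' ≠ h := by rintro rfl; omega
  funext θ'
  simp [Strategy.deviate, hne]

namespace IsEquilibrium

variable {μ : ℝ → ℝ} {T : ℕ} {π₀ : ℝ} {σ : Strategy M} {p : List M → ℝ}

/-- Every message sent with positive probability is a best reply. -/
theorem payoff_eq_of_prob_pos (he : IsEquilibrium μ T π₀ σ p) {h : List M} {n : ℕ}
    (hn : h.length + (n + 1) = T - 1) (θ : State) {m : M} (hm : 0 < σ.prob h θ m) :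
    μ (p (m :: h) - p h) + payoff μ p σ θ n (m :: h) = payoff μ p σ θ (n + 1) h := by
  set f : M → ℝ := fun m => μ (p (m :: h) - p h) + payoff μ p σ θ n (m :: h) with hf
  set v := payoff μ p σ θ (n + 1) h with hv
  have hle : ∀ m, f m ≤ v := by
    intro m
    have := he.optimal h (by omega) θ (σ.deviate h m)
    rwa [show T - 1 - h.length = n + 1 by omega, payoff_deviate] at this
  -- The shortfalls `v - f m` are nonnegative with mean zero, so each vanishes where `m` has
  -- positive probability.
  have hsum : ∑ m, σ.prob h θ m * (v - f m) = 0 := by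
    simp only [mul_sub, Finset.sum_sub_distrib, ← Finset.sum_mul, σ.sum_prob, one_mul]
    rw [hv, payoff, sub_self]
  have := (Finset.sum_eq_zero_iff_of_nonneg fun m _ =>
    mul_nonneg (σ.prob_nonneg h θ m) (sub_nonneg.2 (hle m))).1 hsum m (Finset.mem_univ m)
  rcases mul_eq_zero.1 this with h1 | h1
  · exact absurd h1 hm.ne'
  · exact (sub_eq_zero.1 h1).symm

theorem payoff_of_degenerate (he : IsEquilibrium μ T π₀ σ p) (h0 : μ 0 = 0) {h : List M} {n : ℕ}
    (hn : h.length + n = T - 1) (θ : State) (hp : p h = 0 ∨ p h = 1) :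
    payoff μ p σ θ n h = μ (θ.belief - p h) :=
  payoff_of_belief_const h0 σ θ n h fun h' hs hl => he.degenerate h h' (by omega) hs hp

theorem belief_eq_zero (he : IsEquilibrium μ T π₀ σ p) {h : List M} {m : M}
    (hl : h.length < T - 1) (hp : p h < 1) (hg : σ.prob h .good m = 0)
    (hb : 0 < σ.prob h .bad m) : p (m :: h) = 0 := by
  rw [he.bayes h m hl, hg]
  · simp
  · rw [hg, mul_zero, zero_add]
    exact mul_pos (by linarith) hb

/-- Bayes' rule in product form. -/
theorem belief_mul (he : IsEquilibrium μ T π₀ σ p) {h : List M} {m : M}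
    (hl : h.length < T - 1) (hp : 0 < p h) (hg : 0 < σ.prob h .good m) :
    p (m :: h) * (p h * σ.prob h .good m + (1 - p h) * σ.prob h .bad m) =
      p h * σ.prob h .good m := by
  have h1 : p h ≤ 1 := (he.belief_mem h (by omega)).2
  have hpos : 0 < p h * σ.prob h .good m + (1 - p h) * σ.prob h .bad m :=
    add_pos_of_pos_of_nonneg (mul_pos hp hg)
      (mul_nonneg (by linarith) (σ.prob_nonneg h .bad m))
  rw [he.bayes h m hl hpos, div_mul_cancel₀ _ hpos.ne']

/-- If all messages sent in the good state induce a belief other than the current one, then some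
message is sent in the bad state only. -/
theorem exists_bad_news (he : IsEquilibrium μ T π₀ σ p) {h : List M} (hl : h.length < T - 1)
    (hp : 0 < p h) {b : ℝ} (hb : ∀ m, 0 < σ.prob h .good m → p (m :: h) = b) (hne : b ≠ p h) :
    ∃ m, σ.prob h .good m = 0 ∧ 0 < σ.prob h .bad m := by
  by_contra! hc
  -- Bayes' rule would then hold with the same posterior `b` for all messages; summing over them
  -- gives `b = p h`.
  have key : ∀ m ∈ Finset.univ,
      b * (p h * σ.prob h .good m + (1 - p h) * σ.prob h .bad m) = p h * σ.prob h .good m := by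
    intro m _
    rcases (σ.prob_nonneg h .good m).eq_or_lt with h0 | h0
    · rw [← h0, le_antisymm (hc m h0.symm) (σ.prob_nonneg h .bad m)]
      simp
    · rw [← hb m h0]
      exact he.belief_mul hl hp h0
  have := Finset.sum_congr rfl key
  rw [← Finset.mul_sum, Finset.sum_add_distrib, ← Finset.mul_sum, ← Finset.mul_sum,
    σ.sum_prob, σ.sum_prob] at this
  exact hne (by linarith)

end IsEquilibrium

/-! ### Necessity: indifference of the bad sender along the path -/

variable {μ : ℝ → ℝ} {T : ℕ} {π₀ : ℝ} {σ : Strategy M} {p : List M → ℝ} {b : Fin (T + 1) → ℝ}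

/-- Along a gradual good news path, the bad sender gets as much as from revealing the state. -/
theorem payoff_bad_of_isGradualPath (he : IsEquilibrium μ T π₀ σ p)
    (hb : IsGradualPath T π₀ σ p b) (hT : 2 ≤ T) (h0 : μ 0 = 0) (hπ₀ : 0 < π₀) (n : ℕ)
    (h : List M) (hn : h.length + n = T - 1) (hpos : 0 < historyProb σ .good h) :
    payoff μ p σ .bad n h = μ (-p h) := by
  induction n generalizing h with
  | zero => simp [payoff, State.belief]
  | succ n ih =>
    by_cases h1 : p h = 1
    · rw [he.payoff_of_degenerate h0 hn .bad (.inr h1)]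
      simp [State.belief]
    have hl : h.length < T - 1 := by omega
    have hp1 : p h < 1 := lt_of_le_of_ne (he.belief_mem h hl.le).2 h1
    have hp0 : 0 < p h := by
      rw [hb.belief_eq ⟨h.length, by omega⟩ h rfl hpos]
      have := hb.monotone (Fin.zero_le (Fin.castSucc ⟨h.length, by omega⟩))
      rw [hb.first] at this
      linarith
    by_cases hm : ∃ m, σ.prob h .good m = 0 ∧ 0 < σ.prob h .bad m
    · obtain ⟨m, hg, hbm⟩ := hm
      have hz := he.belief_eq_zero hl hp1 hg hbm
      rw [← he.payoff_eq_of_prob_pos hn .bad hbm,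
        he.payoff_of_degenerate h0 (by simp; omega) .bad (.inl hz), hz]
      simp [State.belief, h0]
    -- Without a message exclusive to the bad state the belief cannot move, so the value is
    -- inherited from the next period.
    · have hnext : ∀ m, 0 < σ.prob h .good m →
          p (m :: h) = b (Fin.castSucc ⟨h.length + 1, by omega⟩) := fun m hg =>
        hb.belief_eq ⟨h.length + 1, by omega⟩ (m :: h) rfl (mul_pos hpos hg)
      have heq : b (Fin.castSucc ⟨h.length + 1, by omega⟩) = p h := by
        by_contra hne
        exact hm (he.exists_bad_news hl hp0 hnext hne)
      refine payoff_succ_eq_of_forall μ p σ .bad n h fun m hbm => ?_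
      have hg : 0 < σ.prob h .good m := by
        refine lt_of_le_of_ne (σ.prob_nonneg h .good m) fun hz => hm ⟨m, hz.symm, hbm⟩
      rw [ih (m :: h) (by simp; omega) (mul_pos hpos hg), hnext m hg, heq, sub_self, h0, zero_add]

/-- At a jump of a gradual good news path to a non-degenerate belief, the bad sender is
indifferent. -/
theorem newsBad_eq_of_isGradualPath (he : IsEquilibrium μ T π₀ σ p)
    (hb : IsGradualPath T π₀ σ p b) (hT : 2 ≤ T) (h0 : μ 0 = 0) (hπ₀ : 0 < π₀) (t : ℕ)
    (ht : t + 1 < T) (hlt : b (Fin.castSucc ⟨t + 1, ht⟩) < 1) :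
    newsBad μ (b (Fin.castSucc ⟨t + 1, ht⟩)) (b (Fin.castSucc ⟨t, by omega⟩)) =
      newsBad μ 0 (b (Fin.castSucc ⟨t, by omega⟩)) := by
  obtain ⟨h, rfl, hpos⟩ := exists_historyProb_pos σ .good t
  obtain ⟨m, hm⟩ := σ.exists_prob_pos h .good
  have hposm : 0 < historyProb σ .good (m :: h) := mul_pos hpos hm
  have hl : h.length < T - 1 := by omega
  obtain ⟨n, hn⟩ : ∃ n, h.length + (n + 1) = T - 1 := ⟨T - 1 - h.length - 1, by omega⟩
  have hph := hb.belief_eq ⟨h.length, by omega⟩ h rfl hpos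
  have hpm := hb.belief_eq ⟨h.length + 1, ht⟩ (m :: h) rfl hposm
  have hp0 : 0 < p h := by
    have := hb.monotone (Fin.zero_le (Fin.castSucc (⟨h.length, by omega⟩ : Fin T)))
    rw [hb.first] at this
    linarith
  -- A message never sent in the bad state would push the belief to `1`.
  have hbm : 0 < σ.prob h .bad m := by
    refine lt_of_le_of_ne (σ.prob_nonneg h .bad m) fun hz => ?_
    have := he.belief_mul hl hp0 hm
    rw [← hz, mul_zero, add_zero] at this
    have h1 : p (m :: h) = 1 := mul_right_cancel₀ (mul_pos hp0 hm).ne' (by rw [this, one_mul])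
    linarith
  have key := he.payoff_eq_of_prob_pos hn .bad hbm
  rw [payoff_bad_of_isGradualPath he hb hT h0 hπ₀ n (m :: h) (by simp; omega) hposm,
    payoff_bad_of_isGradualPath he hb hT h0 hπ₀ (n + 1) h hn hpos, hph, hpm] at key
  simpa [newsBad, h0] using key

end Game

theorem mem_indiffSet_of_existsGradualGoodNews {μ : ℝ → ℝ} (hμ : IsGainLoss μ) {T : ℕ}
    (hT : 2 ≤ T) {π₀ : ℝ} (hπ₀ : π₀ ∈ Set.Ioo (0 : ℝ) 1) {J : ℕ} {q : Fin J → ℝ}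
    (hq : StrictMono q) (hex : ExistsGradualGoodNews μ T π₀ (Set.range q)) (j : Fin J) :
    q j ∈ indiffSet μ ((Fin.cons π₀ q : Fin (J + 1) → ℝ) j.castSucc) := by
  obtain ⟨M, _, σ, p, b, he, hb, hS⟩ := hex
  have hmem : ∀ i, q i ∈ Set.Ioo π₀ 1 ∧ ∃ t : Fin T, b t.castSucc = q i := by
    intro i
    have : q i ∈ intermediateBeliefs T π₀ b := hS ▸ Set.mem_range_self i
    exact ⟨this.1, this.2⟩
  have hex : ∃ t : ℕ, ∃ ht : t < T, b (Fin.castSucc ⟨t, ht⟩) = q j := by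
    obtain ⟨t, ht⟩ := (hmem j).2
    exact ⟨t, t.2, ht⟩
  -- Take the first period in which the path reaches `q j`; the belief just before it must be the
  -- preceding intermediate belief, or the prior.
  classical
  obtain ⟨ht, hbt⟩ := Nat.find_spec hex
  have hmin := fun s => Nat.find_min hex (m := s)
  generalize Nat.find hex = t at ht hbt hmin
  obtain _ | s := t
  · have h0 : b (Fin.castSucc ⟨0, ht⟩) = π₀ := hb.first
    linarith [(hmem j).1.1]
  have hsT : s < T := by omega
  have hle : b (Fin.castSucc ⟨s, hsT⟩) ≤ q j := hbt ▸ hb.monotone (by simp [Fin.le_def])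
  have hlt : b (Fin.castSucc ⟨s, hsT⟩) < q j :=
    lt_of_le_of_ne hle fun h => hmin s (by omega) ⟨hsT, h⟩
  have hfirst : π₀ ≤ b (Fin.castSucc ⟨s, hsT⟩) := hb.first ▸ hb.monotone (Fin.zero_le _)
  have hprev : b (Fin.castSucc ⟨s, hsT⟩) = (Fin.cons π₀ q : Fin (J + 1) → ℝ) j.castSucc := by
    have hcases : b (Fin.castSucc ⟨s, hsT⟩) = π₀ ∨ ∃ i, q i = b (Fin.castSucc ⟨s, hsT⟩) := by
      rcases hfirst.eq_or_lt with h | h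
      · exact .inl h.symm
      · right
        have : b (Fin.castSucc ⟨s, hsT⟩) ∈ intermediateBeliefs T π₀ b :=
          ⟨⟨h, hlt.trans (hmem j).1.2⟩, ⟨s, hsT⟩, rfl⟩
        rwa [hS] at this
    -- From period `s + 1` on beliefs are at least `q j`, so smaller values occur by period `s`.
    have hbelow : ∀ i, i < j → q i ≤ b (Fin.castSucc ⟨s, hsT⟩) := by
      intro i hij
      obtain ⟨u, hu⟩ := (hmem i).2
      rw [← hu]
      apply hb.monotone
      by_contra hcon
      have : b (Fin.castSucc ⟨s + 1, ht⟩) ≤ b u.castSucc := by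
        apply hb.monotone
        simp [Fin.le_def] at hcon ⊢
        omega
      linarith [hq hij]
    obtain ⟨j, hj⟩ := j
    obtain _ | k := j
    · rcases hcases with h | ⟨i, hi⟩
      · simpa using h
      · have : i < ⟨0, hj⟩ := hq.lt_iff_lt.1 (hi ▸ hlt)
        simp [Fin.lt_def] at this
    · have hk : k < J := by omega
      have hc : (Fin.cons π₀ q : Fin (J + 1) → ℝ) (Fin.castSucc ⟨k + 1, hj⟩) = q ⟨k, hk⟩ :=
        Fin.cons_succ (α := fun _ => ℝ) π₀ q ⟨k, hk⟩
      have hb1 := hbelow ⟨k, hk⟩ (by simp [Fin.lt_def])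
      rw [hc]
      refine le_antisymm ?_ hb1
      rcases hcases with h | ⟨i, hi⟩
      · linarith [(hmem ⟨k, hk⟩).1.1]
      · have : i < ⟨k + 1, hj⟩ := hq.lt_iff_lt.1 (hi ▸ hlt)
        rw [← hi]
        apply hq.monotone
        simp [Fin.lt_def, Fin.le_def] at this ⊢
        omega
  rw [← hprev]
  refine ⟨⟨hlt, (hmem j).1.2.le⟩, ?_⟩
  have := newsBad_eq_of_isGradualPath he hb hT hμ.map_zero hπ₀.1 s ht
    (hbt ▸ (hmem j).1.2)
  rwa [hbt] at this

/-! ### Sufficiency: the two-message equilibrium -/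

section Construction

/-- Beliefs when the message `true` is good news moving the belief along the path `c`, and the
message `false` reveals the bad state. -/
noncomputable def pathBelief (c : ℕ → ℝ) (h : List Bool) : ℝ :=
  if false ∈ h then 0 else c h.length

theorem pathBelief_cons_true (c : ℕ → ℝ) {h : List Bool} (hh : false ∉ h) :
    pathBelief c (true :: h) = c (h.length + 1) := by
  simp [pathBelief, hh]

theorem pathBelief_cons_false (c : ℕ → ℝ) (h : List Bool) :
    pathBelief c (false :: h) = 0 := by
  simp [pathBelief]

theorem pathBelief_of_mem (c : ℕ → ℝ) {h : List Bool} (hh : false ∈ h) :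
    pathBelief c h = 0 := by
  simp [pathBelief, hh]

theorem pathBelief_of_notMem (c : ℕ → ℝ) {h : List Bool} (hh : false ∉ h) :
    pathBelief c h = c h.length := by
  simp [pathBelief, hh]

/-- The probability with which the bad sender sends good news, so that the belief moves from `x`
to `y` upon good news. -/
noncomputable def poolProb (x y : ℝ) : ℝ := x * (1 - y) / (y * (1 - x))

theorem poolProb_mem {x y : ℝ} (hx : 0 < x) (hxy : x ≤ y) (hy : y < 1) :
    poolProb x y ∈ Set.Icc (0 : ℝ) 1 := by
  have h1 : 0 < 1 - y := by linarith
  have h2 : 0 < 1 - x := by linarith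
  have h3 : 0 < y := by linarith
  refine ⟨by unfold poolProb; positivity, ?_⟩
  rw [poolProb, div_le_one (by positivity)]
  linarith

theorem bayes_poolProb {x y : ℝ} (hx : 0 < x) (hxy : x ≤ y) (hy : y < 1) :
    x / (x + (1 - x) * poolProb x y) = y := by
  have h2 : 1 - x ≠ 0 := by linarith
  have h3 : y ≠ 0 := by linarith
  have h4 : x + (1 - x) * poolProb x y = x / y := by
    unfold poolProb
    field_simp
    ring
  rw [h4, div_div_cancel₀ hx.ne']

/-- The good sender always sends good news; the bad sender pools with the probability that moves
beliefs along the path `c`. -/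
noncomputable def pathStrategy (c : ℕ → ℝ) (hpos : ∀ t, 0 < c t) (hmono : Monotone c)
    (hlt : ∀ t, c t < 1) : Strategy Bool := fun h θ =>
  match θ with
  | .good => ⟨Pi.single true 1, single_mem_stdSimplex ℝ true⟩
  | .bad => ⟨fun m => cond m (poolProb (c h.length) (c (h.length + 1)))
      (1 - poolProb (c h.length) (c (h.length + 1))), by
        have := poolProb_mem (hpos h.length) (hmono h.length.le_succ) (hlt _)
        refine ⟨?_, by simp⟩
        rintro (_ | _)
        · exact sub_nonneg.2 this.2
        · exact this.1⟩

variable {μ : ℝ → ℝ} {c : ℕ → ℝ} {hpos : ∀ t, 0 < c t} {hmono : Monotone c} {hlt : ∀ t, c t < 1}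

theorem pathStrategy_good_true (h : List Bool) :
    (pathStrategy c hpos hmono hlt).prob h .good true = 1 := by
  simp [Strategy.prob, pathStrategy]

theorem pathStrategy_good_false (h : List Bool) :
    (pathStrategy c hpos hmono hlt).prob h .good false = 0 := by
  simp [Strategy.prob, pathStrategy]

theorem pathStrategy_bad_true (h : List Bool) :
    (pathStrategy c hpos hmono hlt).prob h .bad true =
      poolProb (c h.length) (c (h.length + 1)) := rfl

theorem notMem_of_historyProb_pos (h : List Bool)
    (hh : 0 < historyProb (pathStrategy c hpos hmono hlt) .good h) : false ∉ h := by
  induction h with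
  | nil => simp
  | cons m h ih =>
    cases m with
    | false => simp [historyProb, pathStrategy_good_false] at hh
    | true => simpa using ih (by simpa [historyProb, pathStrategy_good_true] using hh)

theorem payoff_pathBelief_of_mem (h0 : μ 0 = 0) (σ : Strategy Bool) (θ : State) (n : ℕ)
    {h : List Bool} (hh : false ∈ h) :
    payoff μ (pathBelief c) σ θ n h = μ θ.belief := by
  rw [payoff_of_belief_const h0, pathBelief_of_mem c hh, sub_zero]
  intro h' hs _
  rw [pathBelief_of_mem c hh, pathBelief_of_mem c (hs.subset hh)]

/-- The bad sender is indifferent between all strategies. -/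
theorem payoff_pathBelief_bad (h0 : μ 0 = 0)
    (hc : ∀ t, μ (c (t + 1) - c t) + μ (-c (t + 1)) = μ (-c t)) (σ : Strategy Bool) (n : ℕ)
    (h : List Bool) : payoff μ (pathBelief c) σ .bad n h = μ (-pathBelief c h) := by
  induction n generalizing h with
  | zero => simp [payoff, State.belief]
  | succ n ih =>
    refine payoff_succ_eq_of_forall μ _ σ .bad n h fun m _ => ?_
    rw [ih]
    cases m with
    | false => simp [pathBelief_cons_false, h0]
    | true =>
      by_cases hh : false ∈ h
      · simp [pathBelief, hh, h0]
      · rw [pathBelief_cons_true c hh, pathBelief_of_notMem c hh]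
        exact hc _

theorem payoff_pathStrategy_good_succ (n : ℕ) {h : List Bool} (hh : false ∉ h) :
    payoff μ (pathBelief c) (pathStrategy c hpos hmono hlt) .good (n + 1) h =
      μ (c (h.length + 1) - c h.length) +
        payoff μ (pathBelief c) (pathStrategy c hpos hmono hlt) .good n (true :: h) := by
  simp [payoff, pathStrategy_good_true, pathStrategy_good_false, pathBelief_cons_true c hh,
    pathBelief_of_notMem c hh]

/-- Splitting a gain into steps never hurts a subadditive `μ`. -/
theorem le_payoff_pathStrategy_good
    (hsub : ∀ x y : ℝ, 0 ≤ x → 0 ≤ y → x + y ≤ 1 → μ (x + y) ≤ μ x + μ y) (n : ℕ)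
    {h : List Bool} (hh : false ∉ h) :
    μ (1 - c h.length) ≤
      payoff μ (pathBelief c) (pathStrategy c hpos hmono hlt) .good n h := by
  induction n generalizing h with
  | zero => simp [payoff, State.belief, pathBelief_of_notMem c hh]
  | succ n ih =>
    rw [payoff_pathStrategy_good_succ n hh]
    have h1 := ih (h := true :: h) (by simpa using hh)
    have h2 := hsub (c (h.length + 1) - c h.length) (1 - c (h.length + 1))
      (sub_nonneg.2 (hmono h.length.le_succ)) (sub_nonneg.2 (hlt _).le)
      (by linarith [hpos h.length])
    rw [show c (h.length + 1) - c h.length + (1 - c (h.length + 1)) = 1 - c h.length by ring] at h2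
    simp only [List.length_cons] at h1
    linarith

theorem payoff_good_le_pathStrategy (h0 : μ 0 = 0)
    (hsub : ∀ x y : ℝ, 0 ≤ x → 0 ≤ y → x + y ≤ 1 → μ (x + y) ≤ μ x + μ y)
    (hla : LossAversion μ) (σ : Strategy Bool) (n : ℕ) (h : List Bool) :
    payoff μ (pathBelief c) σ .good n h ≤
      payoff μ (pathBelief c) (pathStrategy c hpos hmono hlt) .good n h := by
  induction n generalizing h with
  | zero => exact le_rfl
  | succ n ih =>
    by_cases hh : false ∈ h
    · rw [payoff_pathBelief_of_mem h0 _ _ _ hh, payoff_pathBelief_of_mem h0 _ _ _ hh]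
    set v := payoff μ (pathBelief c) (pathStrategy c hpos hmono hlt) .good (n + 1) h with hv
    have htrue : μ (pathBelief c (true :: h) - pathBelief c h) +
        payoff μ (pathBelief c) σ .good n (true :: h) ≤ v := by
      rw [hv, payoff_pathStrategy_good_succ n hh, pathBelief_cons_true c hh,
        pathBelief_of_notMem c hh]
      linarith [ih (true :: h)]
    have hfalse : μ (pathBelief c (false :: h) - pathBelief c h) +
        payoff μ (pathBelief c) σ .good n (false :: h) ≤ v := by
      -- A false confession costs `μ (-c)` now and brings the surprise `μ 1` at the end; loss
      -- aversion and subadditivity bound the sum by `μ (1 - c)`.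
      rw [payoff_pathBelief_of_mem h0 _ _ _ (by simp), pathBelief_cons_false,
        pathBelief_of_notMem c hh, zero_sub, State.belief]
      have h1 := le_payoff_pathStrategy_good (hpos := hpos) (hmono := hmono) (hlt := hlt)
        hsub (n + 1) hh
      have h2 := hla (c h.length) ⟨hpos _, (hlt _).le⟩
      have h3 := hsub (c h.length) (1 - c h.length) (hpos _).le (by linarith [hlt h.length])
        (by linarith)
      rw [add_sub_cancel] at h3
      linarith
    calc payoff μ (pathBelief c) σ .good (n + 1) h
        ≤ ∑ m : Bool, σ.prob h .good m * v := by
          rw [payoff]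
          refine Finset.sum_le_sum fun m _ =>
            mul_le_mul_of_nonneg_left ?_ (σ.prob_nonneg h .good m)
          cases m
          · exact hfalse
          · exact htrue
      _ = v := by rw [← Finset.sum_mul, σ.sum_prob, one_mul]

theorem isEquilibrium_pathStrategy (h0 : μ 0 = 0)
    (hsub : ∀ x y : ℝ, 0 ≤ x → 0 ≤ y → x + y ≤ 1 → μ (x + y) ≤ μ x + μ y)
    (hla : LossAversion μ) (hc : ∀ t, μ (c (t + 1) - c t) + μ (-c (t + 1)) = μ (-c t)) (T : ℕ) :
    IsEquilibrium μ T (c 0) (pathStrategy c hpos hmono hlt) (pathBelief c) where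
  belief_mem h _ := by
    unfold pathBelief
    split_ifs
    · exact ⟨le_rfl, zero_le_one⟩
    · exact ⟨(hpos _).le, (hlt _).le⟩
  optimal h _ θ σ' := by
    cases θ with
    | good => exact payoff_good_le_pathStrategy h0 hsub hla σ' _ h
    | bad => rw [payoff_pathBelief_bad h0 hc, payoff_pathBelief_bad h0 hc]
  prior := by simp [pathBelief]
  bayes h m _ _ := by
    by_cases hh : false ∈ h
    · rw [pathBelief_of_mem c hh, pathBelief_of_mem c (List.mem_cons_of_mem m hh)]
      simp
    cases m with
    | false => rw [pathBelief_cons_false, pathStrategy_good_false]; simp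
    | true =>
      rw [pathBelief_cons_true c hh, pathBelief_of_notMem c hh, pathStrategy_good_true, mul_one,
        pathStrategy_bad_true, bayes_poolProb (hpos _) (hmono h.length.le_succ) (hlt _)]
  degenerate h h' _ hs hp := by
    by_cases hh : false ∈ h
    · rw [pathBelief_of_mem c hh, pathBelief_of_mem c (hs.subset hh)]
    · rw [pathBelief_of_notMem c hh] at hp
      rcases hp with hp | hp
      · exact absurd hp (hpos _).ne'
      · exact absurd hp (hlt _).ne

theorem isGradualPath_pathStrategy (T : ℕ) (hT : 0 < T) :
    IsGradualPath T (c 0) (pathStrategy c hpos hmono hlt) (pathBelief c)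
      (Fin.snoc (fun t : Fin T => c t) 1 : Fin (T + 1) → ℝ) where
  monotone := by
    intro s t hst
    induction t using Fin.lastCases with
    | last =>
      induction s using Fin.lastCases with
      | last => exact le_rfl
      | cast s => simpa using (hlt s).le
    | cast t =>
      induction s using Fin.lastCases with
      | last => exact absurd hst (by simp [Fin.le_def])
      | cast s =>
        rw [Fin.snoc_castSucc, Fin.snoc_castSucc]
        exact hmono (Fin.le_def.1 hst)
  first := by
    have : (0 : Fin (T + 1)) = Fin.castSucc ⟨0, hT⟩ := rfl
    rw [this, Fin.snoc_castSucc]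
  last := by simp
  belief_eq t h hl hh := by
    rw [pathBelief_of_notMem c (notMem_of_historyProb_pos h hh), Fin.snoc_castSucc, hl]

end Construction

theorem existsGradualGoodNews_of_mem_indiffSet {μ : ℝ → ℝ} (hμ : IsGainLoss μ)
    (hds : DiminishingSensitivity μ) (hla : LossAversion μ) {T : ℕ} (hT : 2 ≤ T) {π₀ : ℝ}
    (hπ₀ : π₀ ∈ Set.Ioo (0 : ℝ) 1) {J : ℕ} (hJT : J ≤ T - 1) {q : Fin J → ℝ}
    (hq1 : ∀ j, q j < 1)
    (hind : ∀ j : Fin J, q j ∈ indiffSet μ ((Fin.cons π₀ q : Fin (J + 1) → ℝ) j.castSucc)) :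
    ExistsGradualGoodNews μ T π₀ (Set.range q) := by
  set d : Fin (J + 1) → ℝ := Fin.cons π₀ q with hd
  have hd_succ : ∀ j : Fin J, d j.succ = q j := fun j =>
    Fin.cons_succ (α := fun _ => ℝ) π₀ q j
  have hd_zero : d 0 = π₀ := rfl
  have hd_mono : StrictMono d := Fin.strictMono_iff_lt_succ.2 fun j => by
    rw [hd_succ]; exact (hind j).1.1
  -- One jump per period, then the belief rests at the last value until the state is revealed; `J ≤
  -- T - 1` leaves enough periods.
  set c : ℕ → ℝ := fun t => d ⟨min t J, by omega⟩ with hcdef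
  have hc0 : c 0 = π₀ := by simp [hcdef, hd_zero]
  have hmono : Monotone c := fun s t hst => hd_mono.monotone (Fin.mk_le_mk.2 (min_le_min_right J hst))
  have hpos : ∀ t, 0 < c t := fun t => hπ₀.1.trans_le (hc0 ▸ hmono (Nat.zero_le t))
  have hlt : ∀ t, c t < 1 := by
    intro t
    have : ∀ i, d i < 1 := by
      intro i
      cases i using Fin.cases with
      | zero => exact hπ₀.2
      | succ j => exact hd_succ j ▸ hq1 j
    exact this _
  have hq_eq : ∀ j : Fin J, c (j + 1) = q j := by
    intro j
    rw [← hd_succ j]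
    exact congrArg d (Fin.ext (by simp))
  have hc : ∀ t, μ (c (t + 1) - c t) + μ (-c (t + 1)) = μ (-c t) := by
    intro t
    by_cases ht : t < J
    · have h1 := (hind ⟨t, ht⟩).2
      have h2 : c t = d (Fin.castSucc ⟨t, ht⟩) := congrArg d (Fin.ext (by simp; omega))
      have h3 : c (t + 1) = q ⟨t, ht⟩ := hq_eq ⟨t, ht⟩
      rw [← h2, ← h3] at h1
      simpa [newsBad, hμ.map_zero] using h1
    · have : c (t + 1) = c t := congrArg d (Fin.ext (by simp; omega))
      rw [this, sub_self, hμ.map_zero, zero_add]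
  have heq := isEquilibrium_pathStrategy (hpos := hpos) (hmono := hmono) (hlt := hlt) hμ.map_zero
    (fun x y => subadditive_of_concaveOn (hμ.concaveOn hds) hμ.map_zero) hla hc T
  have hpath := isGradualPath_pathStrategy (hpos := hpos) (hmono := hmono) (hlt := hlt) T
    (by omega)
  rw [hc0] at heq hpath
  refine ⟨Bool, inferInstance, _, _, _, heq, hpath, ?_⟩
  ext x
  simp only [intermediateBeliefs, Fin.snoc_castSucc, Set.mem_inter_iff, Set.mem_range]
  constructor
  · rintro ⟨hx, t, rfl⟩
    have : ∀ i, π₀ < d i → ∃ j, q j = d i := by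
      intro i hi
      cases i using Fin.cases with
      | zero => exact absurd hi (lt_irrefl _)
      | succ j => exact ⟨j, (hd_succ j).symm⟩
    exact this _ hx.1
  · rintro ⟨j, rfl⟩
    refine ⟨⟨?_, hq1 j⟩, ⟨j + 1, by omega⟩, hq_eq j⟩
    rw [← hd_succ, ← hd_zero]
    exact hd_mono (Fin.succ_pos j)

end NewsUtility

theorem proposition12 (μ : ℝ → ℝ) (hμ : NewsUtility.IsGainLoss μ)
    (hds : NewsUtility.DiminishingSensitivity μ) (hla : NewsUtility.LossAversion μ)
    (T : ℕ) (hT : 2 ≤ T) (π₀ : ℝ) (hπ₀ : π₀ ∈ Set.Ioo (0 : ℝ) 1)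
    (J : ℕ) (hJ : 1 ≤ J) (hJT : J ≤ T - 1)
    (q : Fin J → ℝ) (hq : StrictMono q) (hq1 : ∀ j, q j < 1) :
    NewsUtility.ExistsGradualGoodNews μ T π₀ (Set.range q) ↔
      ∀ j : Fin J, q j ∈ NewsUtility.indiffSet μ
        ((Fin.cons π₀ q : Fin (J + 1) → ℝ) j.castSucc) :=
  ⟨fun h => NewsUtility.mem_indiffSet_of_existsGradualGoodNews hμ hT hπ₀ hq h,
    NewsUtility.existsGradualGoodNews_of_mem_indiffSet hμ hds hla hT hπ₀ hJT hq1⟩
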